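/- Let $G$ be a finite simple undirected graph with $n\ge 5$ vertices, minimum degree $\delta(G)\ge 2$, and $m\ge \binom{n-2}{2}+4$ edges. Write $G_1+G_2$ for the disjoint union of two graphs, $kG$ for the disjoint union of $k$ copies of $G$, and $G_1\vee G_2$ for the join, i.e. the graph obtained from $G_1+G_2$ by joining every vertex of $G_1$ to every vertex of $G_2$; $K_r$ is the complete graph on $r$ vertices and $K_{s,t}$ the complete bipartite graph with parts of sizes $s$ and $t$. Then $G$ contains a Hamilton cycle if and only if $G$ is not isomorphic to any of the nine graphs $$K_2\vee (K_{n-4}+2K_1),\quad K_3\vee 4K_1,\quad K_2\vee (K_{1,3}+K_1),\quad K_1\vee K_{2,4},\quad K_3\vee (K_2+3K_1),$$ $$K_4\vee 5K_1,\quad K_3\vee (K_{1,4}+K_1),\quad K_2\vee K_{2,5},\quad K_5\vee 6K_1.$$ -/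

import Mathlib

namespace HamiltonEdges

/-- The join of two graphs: their disjoint union, together with all edges between the two parts. -/
def join {V W : Type*} (G : SimpleGraph V) (H : SimpleGraph W) : SimpleGraph (V ⊕ W) :=
  SimpleGraph.sum G H ⊔ completeBipartiteGraph V W

/-- The complete graph on `n` vertices. -/
abbrev K (n : ℕ) : SimpleGraph (Fin n) := ⊤

/-- The disjoint union of `k` copies of the one-vertex graph: `k` vertices and no edges. -/
abbrev copiesK1 (k : ℕ) : SimpleGraph (Fin k) := ⊥

/-- The complete bipartite graph with parts of sizes `s` and `t`. -/
abbrev Kbip (s t : ℕ) : SimpleGraph (Fin s ⊕ Fin t) := completeBipartiteGraph (Fin s) (Fin t)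

/-- `G` is, up to isomorphism, one of the nine exceptional graphs; the first one depends on the
number `n` of vertices, the others are fixed graphs. -/
def IsExceptional {V : Type*} (n : ℕ) (G : SimpleGraph V) : Prop :=
  Nonempty (G ≃g join (K 2) (SimpleGraph.sum (K (n - 4)) (copiesK1 2))) ∨
  Nonempty (G ≃g join (K 3) (copiesK1 4)) ∨
  Nonempty (G ≃g join (K 2) (SimpleGraph.sum (Kbip 1 3) (K 1))) ∨
  Nonempty (G ≃g join (K 1) (Kbip 2 4)) ∨
  Nonempty (G ≃g join (K 3) (SimpleGraph.sum (K 2) (copiesK1 3))) ∨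
  Nonempty (G ≃g join (K 4) (copiesK1 5)) ∨
  Nonempty (G ≃g join (K 3) (SimpleGraph.sum (Kbip 1 4) (K 1))) ∨
  Nonempty (G ≃g join (K 2) (Kbip 2 5)) ∨
  Nonempty (G ≃g join (K 5) (copiesK1 6))

end HamiltonEdges

/-! An exceptional graph has sets A and C of equal size, with all neighbours of A in C and some
vertex outside both. A Hamilton cycle would have to alternate between A and C and could never reach
that vertex (`not_isHamiltonian_of_neighbors_subset`).

Conversely, let H be a maximal non-Hamiltonian graph containing G. Ore's argument gives degree sum
below n for nonadjacent vertices of H, and a nonadjacent pair of maximal degree sum yields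
Chvátal-type bounds (`exists_low_degree_sets`): with k the smaller degree, k vertices A have degree
at most k, and n - k vertices S ⊇ A have degree at most n - 1 - k. Summing these bounds and
comparing with 2m leaves few values of k and n, and a total defect D smaller than k
(`defect_cases`). Such a small defect forces the vertices outside S to be adjacent in H to
everything, so A has neighbours only outside S, in H and hence in G. Each edge of G missing from
this pattern costs one unit of defect at both ends. Since D ≤ 2, G is the full pattern or lacks one
edge, which gives the list. -/

open Finset
-- Hamilton paths and cycles: Ore's argument and an obstruction.
namespace SimpleGraph

variable {V : Type*} [Fintype V] [DecidableEq V] {G : SimpleGraph V}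

/-- A Hamiltonian path between adjacent vertices closes up to a Hamiltonian cycle. -/
lemma Walk.IsHamiltonian.isHamiltonian_of_adj (hV : 3 ≤ Fintype.card V) {a b : V} {q : G.Walk a b}
    (hq : q.IsHamiltonian) (h : G.Adj b a) : G.IsHamiltonian := by
  intro _
  have hl := hq.length_eq
  refine ⟨b, .cons h q, ?_⟩
  rw [Walk.isHamiltonianCycle_iff_isCycle_and_length_eq,
    Walk.isCycle_iff_isPath_tail_and_le_length]
  refine ⟨⟨by simpa using hq.isPath, ?_⟩, ?_⟩ <;> rw [Walk.length_cons] <;> omega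

lemma isHamiltonian_top (hV : 3 ≤ Fintype.card V) : (⊤ : SimpleGraph V).IsHamiltonian := by
  intro _
  obtain ⟨v, p, hp, hl⟩ := (cycleGraph_isContained_iff (G := (⊤ : SimpleGraph V)) hV).1
    ⟨⟨⟨(Fintype.equivFin V).symm, fun h => by simpa using h.ne⟩, (Fintype.equivFin V).symm.injective⟩⟩
  exact ⟨v, p, Walk.isHamiltonianCycle_iff_isCycle_and_length_eq.2 ⟨hp, hl⟩⟩

/-- If adding an edge between nonadjacent vertices creates a Hamiltonian cycle, then these two
vertices are joined by a Hamiltonian path. -/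
lemma exists_isHamiltonian_walk_of_sup_edge (hV : 3 ≤ Fintype.card V) {u v : V}
    (hG : ¬ G.IsHamiltonian) (h : (G ⊔ edge u v).IsHamiltonian) :
    ∃ p : G.Walk u v, p.IsHamiltonian := by
  have : Nontrivial V := Fintype.one_lt_card_iff_nontrivial.1 (by omega)
  obtain ⟨c, hc⟩ := h.exists_isHamiltonianCycle u
  have hcl := hc.length_eq
  have key : ∀ c : (G ⊔ edge u v).Walk u u, c.IsHamiltonianCycle → c.snd = v →
      ∃ p : G.Walk u v, p.IsHamiltonian := by
    intro c hc hs
    cases c with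
    | nil => exact absurd rfl hc.isCycle.ne_nil
    | cons hadj q =>
      rename_i w
      obtain rfl : w = v := by simpa using hs
      have hcl := hc.length_eq
      obtain ⟨hq, he⟩ := (Walk.cons_isCycle_iff q hadj).1 hc.isCycle
      have ht : ∀ e ∈ q.edges, e ∈ G.edgeSet := by
        intro e heq
        have hmem := q.edges_subset_edgeSet heq
        rw [edgeSet_sup] at hmem
        refine hmem.resolve_right fun h2 => he ?_
        have := (edgeSet_edge u w ▸ h2).1
        rw [Set.mem_singleton_iff] at this
        exact this ▸ heq
      refine ⟨(q.transfer G ht).reverse, ?_⟩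
      rw [Walk.isHamiltonian_iff_isPath_and_length_eq]
      rw [Walk.length_cons] at hcl
      exact ⟨(hq.transfer ht).reverse, by rw [Walk.length_reverse, Walk.length_transfer]; omega⟩
  by_cases hmem : s(u, v) ∈ c.edges
  · cases c with
    | nil => exact absurd rfl hc.isCycle.ne_nil
    | cons hadj q =>
      rename_i w
      rw [Walk.edges_cons, List.mem_cons] at hmem
      obtain ⟨hq, he⟩ := (Walk.cons_isCycle_iff q hadj).1 hc.isCycle
      rcases hmem with hmem | hmem
      -- The edge uv meets the base vertex u, so it is the first or the last edge of the cycle;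
      -- reversal reduces the last to the first.
      · refine key _ hc ?_
        simpa using (Sym2.congr_right.1 hmem).symm
      · have hv := hq.eq_penultimate_of_mem_edges hmem
        refine key (Walk.cons hadj q).reverse ?_ ?_
        · rw [Walk.isHamiltonianCycle_iff_isCycle_and_length_eq]
          exact ⟨hc.isCycle.reverse, by rw [Walk.length_reverse, hcl]⟩
        · rw [Walk.snd_reverse, Walk.penultimate_cons_of_not_nil]
          exacts [hv.symm, Walk.not_nil_of_isCycle_cons hc.isCycle]
  · refine absurd ?_ hG
    have ht : ∀ e ∈ c.edges, e ∈ G.edgeSet := by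
      intro e he
      have := c.edges_subset_edgeSet he
      rw [edgeSet_sup] at this
      refine this.resolve_right fun h2 => hmem ?_
      have := (edgeSet_edge u v ▸ h2).1
      rw [Set.mem_singleton_iff] at this
      exact this ▸ he
    refine fun _ => ⟨u, c.transfer G ht, ?_⟩
    rw [Walk.isHamiltonianCycle_iff_isCycle_and_length_eq]
    exact ⟨hc.isCycle.transfer ht, by rw [Walk.length_transfer, hcl]⟩

/-- **Ore's crossing argument**: the end vertices of a Hamiltonian path in a non-Hamiltonian graph
have degree sum less than the number of vertices. -/
lemma Walk.IsHamiltonian.degree_add_degree_lt [DecidableRel G.Adj] (hV : 3 ≤ Fintype.card V)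
    (hG : ¬ G.IsHamiltonian) {u v : V} {p : G.Walk u v} (hp : p.IsHamiltonian) :
    G.degree u + G.degree v < Fintype.card V := by
  have hl := hp.length_eq
  set n := Fintype.card V
  have hsurj : ∀ w, ∃ i ≤ n - 1, p.getVert i = w := by
    intro w
    obtain ⟨i, h1, h2⟩ := Walk.mem_support_iff_exists_getVert.1 (hp.mem_support w)
    exact ⟨i, by omega, h1⟩
  let S := (range (n - 1)).filter fun i => G.Adj u (p.getVert (i + 1))
  let T := (range (n - 1)).filter fun i => G.Adj v (p.getVert i)
  have hS : G.degree u ≤ #S := by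
    rw [← card_neighborFinset_eq_degree]
    refine (card_le_card ?_).trans (card_image_le (s := S) (f := fun i => p.getVert (i + 1)))
    intro w hw
    rw [mem_neighborFinset] at hw
    obtain ⟨i, hi, rfl⟩ := hsurj w
    rw [mem_image]
    cases i with
    | zero => simp at hw
    | succ i => exact ⟨i, by simp [S, hw]; omega, rfl⟩
  have hT : G.degree v ≤ #T := by
    rw [← card_neighborFinset_eq_degree]
    refine (card_le_card ?_).trans (card_image_le (s := T) (f := fun i => p.getVert i))
    intro w hw
    rw [mem_neighborFinset] at hw
    obtain ⟨i, hi, rfl⟩ := hsurj w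
    rw [mem_image]
    refine ⟨i, ?_, rfl⟩
    -- The path ends at v, which is not its own neighbour.
    have : i ≠ n - 1 := by
      rintro rfl
      rw [← hl, Walk.getVert_length] at hw
      exact hw.ne rfl
    simp [T, hw]; omega
  have hdisj : Disjoint S T := by
    rw [Finset.disjoint_left]
    intro i h1 h2
    simp only [S, T, mem_filter, mem_range] at h1 h2
    refine hG ?_
    -- Follow p from u to its i-th vertex, jump to v, and return along p to vertex i + 1, a
    -- neighbour of u.
    let q := (p.take i).append (.cons h2.2.symm (p.drop (i + 1)).reverse)
    refine Walk.IsHamiltonian.isHamiltonian_of_adj hV (q := q) ?_ h1.2.symm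
    intro w
    refine Eq.trans ?_ (hp w)
    simp only [q, Walk.support_append, Walk.support_cons, List.tail_cons, Walk.support_reverse,
      Walk.support_take, List.count_append, List.count_reverse]
    rw [Walk.drop_support_eq_support_drop_min, ← List.count_append, min_eq_left (by omega),
      List.take_append_drop]
  have := card_le_card (union_subset (filter_subset _ _) (filter_subset _ _) : S ∪ T ⊆ range (n - 1))
  rw [card_union_of_disjoint hdisj, card_range] at this
  omega

/-- The vertices of a Hamiltonian graph have a cyclic enumeration in which consecutive vertices are
adjacent. -/
lemma IsHamiltonian.exists_equiv_adj {m : ℕ} (hV : Fintype.card V = m + 1) (hm : m ≠ 0)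
    (hG : G.IsHamiltonian) : ∃ e : Fin (m + 1) ≃ V, ∀ i, G.Adj (e i) (e (i + 1)) := by
  obtain ⟨v, c, hc⟩ := hG (by omega)
  have hl : c.tail.support.length = m + 1 := by
    rw [Walk.length_support, hc.isHamiltonian_tail.length_eq]; omega
  have htl : c.tail.length = m := by rw [Walk.length_support] at hl; omega
  refine ⟨(finCongr hl.symm).trans hc.isHamiltonian_tail.getVertEquiv, fun i => ?_⟩
  simp only [Equiv.trans_apply, Walk.IsHamiltonian.getVertEquiv_apply, Function.comp_apply,
    finCongr_apply, Fin.val_cast]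
  by_cases hi : i = Fin.last m
  · subst hi
    rw [Fin.last_add_one, Fin.val_last, Fin.val_zero, Walk.getVert_of_length_le _ htl.le,
      Walk.getVert_zero]
    exact c.adj_snd hc.isCycle.not_nil
  · have hlt : (i : ℕ) < m := Fin.val_lt_last hi
    rw [Fin.val_add_one_of_lt (Fin.lt_last_iff_ne_last.2 hi)]
    exact c.tail.adj_getVert_succ (by omega)

open scoped Fin.CommRing in
/-- If the neighbours of a nonempty set `A` lie in a set `C` of the same size, then a Hamiltonian
cycle alternates between `A` and `C`, so that there are no other vertices. -/
lemma not_isHamiltonian_of_neighbors_subset (A C : Finset V) (hA : A.Nonempty) (hAC : #A = #C)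
    (hN : ∀ a ∈ A, ∀ w, G.Adj a w → w ∈ C) {x : V} (hxA : x ∉ A) (hxC : x ∉ C) :
    ¬ G.IsHamiltonian := by
  intro hG
  obtain ⟨a, ha⟩ := hA
  have h2 : 1 < Fintype.card V := Fintype.one_lt_card_iff.2 ⟨a, x, fun h => hxA (h ▸ ha)⟩
  obtain ⟨m, hm⟩ : ∃ m, Fintype.card V = m + 1 := ⟨Fintype.card V - 1, by omega⟩
  obtain ⟨e, he⟩ := hG.exists_equiv_adj hm (by omega)
  let I := A.map e.symm.toEmbedding
  let J := C.map e.symm.toEmbedding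
  have hI : ∀ i, i ∈ I ↔ e i ∈ A := fun i => by simp [I]
  have hJ : ∀ i, i ∈ J ↔ e i ∈ C := fun i => by simp [J]
  have hIJ : ∀ i ∈ I, i + 1 ∈ J := fun i hi =>
    (hJ _).2 (hN _ ((hI _).1 hi) _ (he i))
  have hsub : I.map (Equiv.subRight 1).toEmbedding ⊆ J := by
    intro j hj
    obtain ⟨i, hi, rfl⟩ := mem_map.1 hj
    refine (hJ _).2 (hN _ ((hI _).1 hi) _ (G.adj_symm ?_))
    simpa using he (i - 1)
  -- Equal sizes turn I - 1 ⊆ J into equality, so J + 1 = I; then I ∪ J is closed under successor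
  -- and fills the cycle.
  have heq := eq_of_subset_of_card_le hsub (by simp [I, J, hAC])
  have hJI : ∀ j ∈ J, j + 1 ∈ I := by
    intro j hj
    rw [← heq] at hj
    obtain ⟨i, hi, rfl⟩ := mem_map.1 hj
    simpa using hi
  have hall : ∀ k : ℕ, e.symm a + (k : Fin (m + 1)) ∈ I ∪ J := by
    intro k
    induction k with
    | zero => simp [I, ha]
    | succ k ih =>
      rw [Nat.cast_succ, ← add_assoc, mem_union]
      exact (mem_union.1 ih).symm.imp (hJI _) (hIJ _)
  have := hall (e.symm x - e.symm a : Fin (m + 1)).val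
  rw [Fin.cast_val_eq_self, add_sub_cancel, mem_union, hI, hJ, e.apply_symm_apply] at this
  exact this.elim hxA hxC

end SimpleGraph
namespace HamiltonEdges

/-! ### Recognising the joins from vertex classes. -/

section Iso

/-- Two graphs in which adjacency of distinct vertices depends only on their classes are isomorphic
as soon as corresponding classes have the same size. -/
lemma nonempty_iso_of_classes {V W ι : Type*} [Fintype V] [Fintype W] [DecidableEq ι]
    {G : SimpleGraph V} {H : SimpleGraph W} (c : V → ι) (d : W → ι) (R : ι → ι → Prop)
    (hcard : ∀ i, #{v | c v = i} = #{w | d w = i})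
    (hG : ∀ u v, G.Adj u v ↔ u ≠ v ∧ R (c u) (c v))
    (hH : ∀ u v, H.Adj u v ↔ u ≠ v ∧ R (d u) (d v)) : Nonempty (G ≃g H) := by
  have hfib : ∀ i, Nonempty ({v // c v = i} ≃ {w // d w = i}) := by
    intro i
    rw [← Fintype.card_eq, Fintype.card_subtype, Fintype.card_subtype]
    exact hcard i
  let f := fun i => (hfib i).some
  let e : V ≃ W := (Equiv.sigmaFiberEquiv c).symm.trans
    ((Equiv.sigmaCongrRight f).trans (Equiv.sigmaFiberEquiv d))
  have he : ∀ v, d (e v) = c v := fun v => (f (c v) ⟨v, rfl⟩).2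
  exact ⟨⟨e, fun {u v} => by rw [hG, hH, he, he, e.injective.ne_iff]⟩⟩

variable {V : Type*} [Fintype V] {G : SimpleGraph V}

lemma nonempty_iso_join_sum {a b l : ℕ} (c : V → Fin 3)
    (h0 : #{v | c v = 0} = a) (h1 : #{v | c v = 1} = b)
    (h2 : #{v | c v = 2} = l)
    (hG : ∀ u v, G.Adj u v ↔ u ≠ v ∧ (c u = 0 ∨ c v = 0 ∨ (c u = 1 ∧ c v = 1))) :
    Nonempty (G ≃g join (K a) (SimpleGraph.sum (K b) (copiesK1 l))) := by
  refine nonempty_iso_of_classes c (Sum.elim (fun _ => 0) (Sum.elim (fun _ => 1) fun _ => 2))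
    (fun i j => i = 0 ∨ j = 0 ∨ (i = 1 ∧ j = 1)) ?_ hG ?_
  · intro i
    fin_cases i
    · exact h0.trans <| by
        simp only [card_filter, Fintype.sum_sum_type, Sum.elim_inl, Sum.elim_inr]
        simp
    · exact h1.trans <| by
        simp only [card_filter, Fintype.sum_sum_type, Sum.elim_inl, Sum.elim_inr]
        simp
    · exact h2.trans <| by
        simp only [card_filter, Fintype.sum_sum_type, Sum.elim_inl, Sum.elim_inr]
        simp
  · rintro (u | u | u) (v | v | v) <;> simp [join]

lemma nonempty_iso_join_copiesK1 {a l : ℕ} (c : V → Fin 2)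
    (h0 : #{v | c v = 0} = a) (h1 : #{v | c v = 1} = l)
    (hG : ∀ u v, G.Adj u v ↔ u ≠ v ∧ (c u = 0 ∨ c v = 0)) :
    Nonempty (G ≃g join (K a) (copiesK1 l)) := by
  refine nonempty_iso_of_classes c (Sum.elim (fun _ => 0) (fun _ => 1))
    (fun i j => i = 0 ∨ j = 0) ?_ hG ?_
  · intro i
    fin_cases i
    · exact h0.trans <| by
        simp only [card_filter, Fintype.sum_sum_type, Sum.elim_inl, Sum.elim_inr]
        simp
    · exact h1.trans <| by
        simp only [card_filter, Fintype.sum_sum_type, Sum.elim_inl, Sum.elim_inr]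
        simp
  · rintro (u | u) (v | v) <;> simp [join]

lemma nonempty_iso_join_Kbip {a b l : ℕ} (c : V → Fin 3)
    (h0 : #{v | c v = 0} = a) (h1 : #{v | c v = 1} = b)
    (h2 : #{v | c v = 2} = l)
    (hG : ∀ u v, G.Adj u v ↔ u ≠ v ∧ (c u = 0 ∨ c v = 0 ∨ (c u = 1 ∧ c v = 2) ∨ c u = 2 ∧ c v = 1)) :
    Nonempty (G ≃g join (K a) (Kbip b l)) := by
  refine nonempty_iso_of_classes c (Sum.elim (fun _ => 0) (Sum.elim (fun _ => 1) fun _ => 2))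
    (fun i j => i = 0 ∨ j = 0 ∨ (i = 1 ∧ j = 2) ∨ i = 2 ∧ j = 1) ?_ hG ?_
  · intro i
    fin_cases i
    · exact h0.trans <| by
        simp only [card_filter, Fintype.sum_sum_type, Sum.elim_inl, Sum.elim_inr]
        simp
    · exact h1.trans <| by
        simp only [card_filter, Fintype.sum_sum_type, Sum.elim_inl, Sum.elim_inr]
        simp
    · exact h2.trans <| by
        simp only [card_filter, Fintype.sum_sum_type, Sum.elim_inl, Sum.elim_inr]
        simp
  · rintro (u | u | u) (v | v | v) <;> simp [join]

lemma nonempty_iso_join_Kbip_sum {a b l s : ℕ} (c : V → Fin 4)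
    (h0 : #{v | c v = 0} = a) (h1 : #{v | c v = 1} = b)
    (h2 : #{v | c v = 2} = l) (h3 : #{v | c v = 3} = s)
    (hG : ∀ u v, G.Adj u v ↔ u ≠ v ∧ (c u = 0 ∨ c v = 0 ∨ (c u = 1 ∧ c v = 2) ∨
      (c u = 2 ∧ c v = 1) ∨ (c u = 3 ∧ c v = 3))) :
    Nonempty (G ≃g join (K a) (SimpleGraph.sum (Kbip b l) (K s))) := by
  refine nonempty_iso_of_classes c
    (Sum.elim (fun _ => 0) (Sum.elim (Sum.elim (fun _ => 1) fun _ => 2) fun _ => 3))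
    (fun i j => i = 0 ∨ j = 0 ∨ (i = 1 ∧ j = 2) ∨ (i = 2 ∧ j = 1) ∨ (i = 3 ∧ j = 3)) ?_ hG ?_
  · intro i
    fin_cases i
    · exact h0.trans <| by
        simp only [card_filter, Fintype.sum_sum_type, Sum.elim_inl, Sum.elim_inr]
        simp
    · exact h1.trans <| by
        simp only [card_filter, Fintype.sum_sum_type, Sum.elim_inl, Sum.elim_inr]
        simp
    · exact h2.trans <| by
        simp only [card_filter, Fintype.sum_sum_type, Sum.elim_inl, Sum.elim_inr]
        simp
    · exact h3.trans <| by
        simp only [card_filter, Fintype.sum_sum_type, Sum.elim_inl, Sum.elim_inr]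
        simp
  · rintro (u | (u | u) | u) (v | (v | v) | v) <;> simp [join]

end Iso

/-! ### The exceptional graphs are not Hamiltonian. -/

section NotHamiltonian

lemma not_isHamiltonian_of_iso {V W : Type*} [Fintype V] [DecidableEq V] [Fintype W] [DecidableEq W]
    {G : SimpleGraph V} {H : SimpleGraph W} (e : Nonempty (G ≃g H)) (hH : ¬ H.IsHamiltonian) :
    ¬ G.IsHamiltonian := by
  obtain ⟨e⟩ := e
  refine fun hG => hH fun h => ?_
  obtain ⟨a, p, hp⟩ := hG (Fintype.card_congr e.toEquiv ▸ h)
  exact ⟨_, p.map e.toHom, hp.map e.bijective⟩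

lemma not_isHamiltonian_join_sum (k m : ℕ) (hk : k ≠ 0) :
    ¬ (join (K k) (SimpleGraph.sum (K (m + 1)) (copiesK1 k))).IsHamiltonian := by
  have : NeZero k := ⟨hk⟩
  refine SimpleGraph.not_isHamiltonian_of_neighbors_subset (disjSum ∅ (disjSum ∅ univ))
    (disjSum univ ∅) ⟨.inr (.inr 0), by simp⟩ (by simp) ?_ (x := .inr (.inl 0)) (by simp) (by simp)
  rintro (u | u | u) hu (v | v | v) <;> simp [join] at hu ⊢

lemma not_isHamiltonian_join_copiesK1 (k : ℕ) (hk : k ≠ 0) :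
    ¬ (join (K k) (copiesK1 (k + 1))).IsHamiltonian := by
  have : NeZero k := ⟨hk⟩
  refine SimpleGraph.not_isHamiltonian_of_neighbors_subset (disjSum ∅ (univ.erase 0))
    (disjSum univ ∅) ⟨.inr 1, by simp⟩ (by simp) ?_ (x := .inr 0) (by simp) (by simp)
  rintro (u | u) hu (v | v) <;> simp [join] at hu ⊢

lemma not_isHamiltonian_join_Kbip_sum (k : ℕ) :
    ¬ (join (K k) (SimpleGraph.sum (Kbip 1 (k + 1)) (K 1))).IsHamiltonian := by
  refine SimpleGraph.not_isHamiltonian_of_neighbors_subset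
    (disjSum ∅ (disjSum (disjSum ∅ univ) ∅)) (disjSum univ (disjSum (disjSum univ ∅) ∅))
    ⟨.inr (.inl (.inr 0)), by simp⟩ (by simp) ?_ (x := .inr (.inr 0)) (by simp) (by simp)
  rintro (u | (u | u) | u) hu (v | (v | v) | v) <;> simp [join] at hu ⊢
  exact Subsingleton.elim _ _

/-- Of the k + 3 independent vertices, k + 2 form A, whose neighbours are the k + 2 vertices outside
the large part; the one left over is unreachable. -/
lemma not_isHamiltonian_join_Kbip (k : ℕ) :
    ¬ (join (K k) (Kbip 2 (k + 3))).IsHamiltonian := by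
  refine SimpleGraph.not_isHamiltonian_of_neighbors_subset
    (disjSum ∅ (disjSum ∅ (univ.erase 0))) (disjSum univ (disjSum univ ∅))
    ⟨.inr (.inr 1), by simp⟩ (by simp) ?_ (x := .inr (.inr 0)) (by simp) (by simp)
  rintro (u | u | u) hu (v | v | v) <;> simp [join] at hu ⊢

lemma IsExceptional.not_isHamiltonian {V : Type*} [Fintype V] [DecidableEq V] {G : SimpleGraph V}
    {n : ℕ} (hn : 5 ≤ n) (h : IsExceptional n G) : ¬ G.IsHamiltonian := by
  -- This makes the clique of order n - 4 visibly nonempty; it supplies the unreachable vertex in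
  -- the first family.
  obtain ⟨m, rfl⟩ : ∃ m, n = m + 1 + 4 := ⟨n - 5, by omega⟩
  rcases h with h | h | h | h | h | h | h | h | h
  · exact not_isHamiltonian_of_iso h (not_isHamiltonian_join_sum 2 m (by simp))
  · exact not_isHamiltonian_of_iso h (not_isHamiltonian_join_copiesK1 3 (by simp))
  · exact not_isHamiltonian_of_iso h (not_isHamiltonian_join_Kbip_sum 2)
  · exact not_isHamiltonian_of_iso h (not_isHamiltonian_join_Kbip 1)
  · exact not_isHamiltonian_of_iso h (not_isHamiltonian_join_sum 3 1 (by simp))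
  · exact not_isHamiltonian_of_iso h (not_isHamiltonian_join_copiesK1 4 (by simp))
  · exact not_isHamiltonian_of_iso h (not_isHamiltonian_join_Kbip_sum 3)
  · exact not_isHamiltonian_of_iso h (not_isHamiltonian_join_Kbip 2)
  · exact not_isHamiltonian_of_iso h (not_isHamiltonian_join_copiesK1 5 (by simp))

end NotHamiltonian

end HamiltonEdges
-- Degree bounds and the edge count.
namespace HamiltonEdges

lemma not_mem_or_of_adj {V : Type*} {G : SimpleGraph V} {A S : Finset V}
    (hN : ∀ a ∈ A, ∀ w, G.Adj a w → w ∉ S) {x y : V} (hxy : G.Adj x y) :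
    x ∉ S ∨ y ∉ S ∨ (x ∉ A ∧ y ∉ A) := by
  by_contra! h
  by_cases hx : x ∈ A
  · exact hN x hx y hxy h.2.1
  · exact hN y (h.2.2 hx) x hxy.symm h.1

variable {V : Type*} [Fintype V]

lemma sum_degree_add_sum_defect (G : SimpleGraph V) [DecidableRel G.Adj] (b : V → ℕ)
    (hb : ∀ w, G.degree w ≤ b w) :
    2 * #G.edgeFinset + ∑ w, (b w - G.degree w) = ∑ w, b w := by
  rw [← G.sum_degrees_eq_twice_card_edges, ← sum_add_distrib]
  exact sum_congr rfl fun w _ => Nat.add_sub_of_le (hb w)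

lemma degree_lt_of_not_adj {G : SimpleGraph V} [DecidableRel G.Adj] {T : Finset V} {x y : V}
    (hx : ∀ w, G.Adj x w → w ∈ T) (hy : y ∈ T) (h : ¬ G.Adj x y) : G.degree x < #T := by
  rw [← G.card_neighborFinset_eq_degree]
  refine card_lt_card ((ssubset_iff_of_subset fun w hw => ?_).2 ⟨y, hy, by simpa using h⟩)
  exact hx w (by simpa using hw)

variable [DecidableEq V]

/-- Degree bounds in the style of Chvátal for a noncomplete graph in which nonadjacent vertices have
degree sum less than the number of vertices. -/
lemma exists_low_degree_sets {G : SimpleGraph V} [DecidableRel G.Adj] {n : ℕ}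
    (hV : Fintype.card V = n)
    (hsum : ∀ u v, u ≠ v → ¬ G.Adj u v → G.degree u + G.degree v < n) (hG : G ≠ ⊤) :
    ∃ u, ∃ A S : Finset V, A ⊆ S ∧ 2 * G.degree u < n ∧ #A = G.degree u ∧ #S = n - G.degree u ∧
      (∀ a ∈ A, G.degree a ≤ G.degree u) ∧ ∀ s ∈ S, G.degree s + G.degree u < n := by
  have hne : (univ.filter fun p : V × V => p.1 ≠ p.2 ∧ ¬ G.Adj p.1 p.2).Nonempty := by
    by_contra! h
    refine hG (SimpleGraph.ext (funext₂ fun u v => propext ?_))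
    rw [SimpleGraph.top_adj]
    refine ⟨fun h => h.ne, fun huv => by_contra fun hadj => ?_⟩
    exact notMem_empty (u, v) (h ▸ mem_filter.2 ⟨mem_univ _, huv, hadj⟩)
  -- By maximality, non-neighbours of v have degree at most that of u, and vice versa. These supply
  -- A and S.
  obtain ⟨⟨u, v⟩, huv, hmax⟩ := exists_max_image _ (fun p => G.degree p.1 + G.degree p.2) hne
  simp only [mem_filter, mem_univ, true_and, Prod.forall] at huv hmax
  obtain ⟨huv, hadj⟩ := huv
  wlog hle : G.degree u ≤ G.degree v generalizing u v
  · refine this v u (fun a b h => ?_) huv.symm (fun h => hadj h.symm) (by omega)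
    rw [add_comm (G.degree v)]
    exact hmax a b h
  have hlt := hsum u v huv hadj
  have hcompl : ∀ w, #(insert w (G.neighborFinset w))ᶜ = n - (G.degree w + 1) := by
    intro w
    rw [card_compl, card_insert_of_notMem (by simp), G.card_neighborFinset_eq_degree, hV]
  have hA1 : ∀ w ∈ (insert v (G.neighborFinset v))ᶜ, G.degree w ≤ G.degree u := by
    intro w hw
    simp only [mem_compl, mem_insert, SimpleGraph.mem_neighborFinset, not_or] at hw
    have := hmax w v ⟨hw.1, fun h => hw.2 h.symm⟩
    omega
  obtain ⟨A, hAsub, hA⟩ := exists_subset_card_eq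
    (s := (insert v (G.neighborFinset v))ᶜ) (n := G.degree u) (by rw [hcompl]; omega)
  have hS1 : ∀ w ∈ (insert u (G.neighborFinset u))ᶜ, G.degree w ≤ G.degree v := by
    intro w hw
    simp only [mem_compl, mem_insert, SimpleGraph.mem_neighborFinset, not_or] at hw
    have := hmax u w ⟨fun h => hw.1 h.symm, hw.2⟩
    omega
  have hT : n - G.degree u ≤ #(univ.filter fun w => G.degree w + G.degree u < n) := by
    have hu : u ∉ (insert u (G.neighborFinset u))ᶜ := by simp
    have h1 := card_insert_of_notMem hu
    rw [hcompl] at h1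
    have h2 : insert u (insert u (G.neighborFinset u))ᶜ ⊆
        univ.filter fun w => G.degree w + G.degree u < n := by
      intro w hw
      rw [mem_filter]
      refine ⟨mem_univ _, ?_⟩
      rcases mem_insert.1 hw with rfl | hw
      · omega
      · have := hS1 w hw
        omega
    have := card_le_card h2
    omega
  obtain ⟨S, hAS, hSsub, hS⟩ := exists_subsuperset_card_eq (s := A)
    (t := univ.filter fun w => G.degree w + G.degree u < n) (n := n - G.degree u)
    (fun a ha => mem_filter.2 ⟨mem_univ _, by have := hA1 a (hAsub ha); omega⟩) (by omega) hT
  exact ⟨u, A, S, hAS, by omega, hA, hS, fun a ha => hA1 a (hAsub ha),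
    fun s hs => (mem_filter.1 (hSsub hs)).2⟩

/-- The degree bound attached to the sets of `exists_low_degree_sets`. -/
def degreeBound (A S : Finset V) (k n : ℕ) (w : V) : ℕ :=
  if w ∈ A then k else if w ∈ S then n - 1 - k else n - 1

lemma sum_degreeBound {A S : Finset V} (hAS : A ⊆ S) {k r : ℕ}
    (hV : Fintype.card V = 2 * k + 1 + r) (hA : #A = k) (hS : #S = k + 1 + r) :
    ∑ w, degreeBound A S k (2 * k + 1 + r) w =
      k * k + (r + 1) * (k + r) + k * (2 * k + r) := by
  have h1 : ∑ w ∈ A, degreeBound A S k (2 * k + 1 + r) w = k * k := by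
    rw [sum_congr rfl (g := fun _ => k), sum_const, hA, smul_eq_mul]
    exact fun w hw => if_pos hw
  have h2 : ∑ w ∈ S \ A, degreeBound A S k (2 * k + 1 + r) w = (r + 1) * (k + r) := by
    rw [sum_congr rfl (g := fun _ => k + r), sum_const, card_sdiff_of_subset hAS, hA, hS,
      smul_eq_mul]
    · congr 1; omega
    · intro w hw
      rw [mem_sdiff] at hw
      rw [degreeBound, if_neg hw.2, if_pos hw.1]; omega
  have h3 : ∑ w ∈ Sᶜ, degreeBound A S k (2 * k + 1 + r) w = k * (2 * k + r) := by
    rw [sum_congr rfl (g := fun _ => 2 * k + r), sum_const, card_compl, hV, hS, smul_eq_mul]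
    · congr 1; omega
    · intro w hw
      rw [mem_compl] at hw
      rw [degreeBound, if_neg fun h => hw (hAS h), if_neg hw]; omega
  rw [← sum_add_sum_compl S, h3, ← sum_sdiff hAS, h1, h2]
  ring

/-- The parameters for which the degree bounds are compatible with the number of edges, and the
resulting bounds on the total defect. -/
lemma defect_cases {k r m D : ℕ} (hk : 2 ≤ k)
    (hm : (2 * k + 1 + r - 2).choose 2 + 4 ≤ m)
    (hD : 2 * m + D = k * k + (r + 1) * (k + r) + k * (2 * k + r)) :
    (k = 2 ∧ D = 0) ∨ (k = 3 ∧ r = 0 ∧ D ≤ 2) ∨ (k = 3 ∧ r = 1 ∧ D = 0) ∨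
      (k = 4 ∧ r = 0 ∧ D ≤ 2) ∨ (k = 5 ∧ r = 0 ∧ D = 0) := by
  obtain ⟨j, rfl⟩ : ∃ j, k = j + 2 := ⟨k - 2, by omega⟩
  have hc : (2 * (j + 2) + 1 + r - 2).choose 2 * 2 = (2 * j + r + 3) * (2 * j + r + 2) := by
    rw [show 2 * (j + 2) + 1 + r - 2 = (2 * j + r + 2) + 1 by omega, Nat.choose_two_right,
      Nat.div_mul_cancel (Nat.even_mul_pred_self _).two_dvd]
    rfl
  -- The sum of the bounds exceeds 2 * (choose + 4) by exactly 3j - j² - 2jr.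
  have h : D + j * j + 2 * (j * r) ≤ 3 * j := by nlinarith
  have hj : j ≤ 3 := by nlinarith
  interval_cases j
  · left; omega
  · omega
  · omega
  · omega

lemma add_le_sum_of_ne (d : V → ℕ) {x y : V} (hxy : x ≠ y) : d x + d y ≤ ∑ w, d w := by
  rw [← sum_pair hxy]
  exact sum_le_sum_of_subset (subset_univ _)

lemma add_add_le_sum_of_ne (d : V → ℕ) {x y z : V} (hxy : x ≠ y) (hxz : x ≠ z) (hyz : y ≠ z) :
    d x + d y + d z ≤ ∑ w, d w := by
  rw [add_assoc, ← sum_pair hyz, ← sum_insert (by simp [hxy, hxz])]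
  exact sum_le_sum_of_subset (subset_univ _)

/-! ### The full pattern, and the pattern with one edge removed. -/

section AdjIso

variable {G : SimpleGraph V} {A S : Finset V}

lemma nonempty_iso_join_sum_of_adj (hAS : A ⊆ S)
    (hadj : ∀ u v, G.Adj u v ↔ u ≠ v ∧ (u ∉ S ∨ v ∉ S ∨ (u ∉ A ∧ v ∉ A))) :
    Nonempty (G ≃g join (K #Sᶜ) (SimpleGraph.sum (K #(S \ A)) (copiesK1 #A))) := by
  have hAS' : ∀ v, v ∉ S → v ∉ A := fun v hv h => hv (hAS h)
  refine nonempty_iso_join_sum (fun v => if v ∉ S then 0 else if v ∉ A then 1 else 2) ?_ ?_ ?_ ?_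
  · refine congrArg card (ext fun v => ?_)
    by_cases hv : v ∈ S <;> by_cases hv' : v ∈ A <;> simp [hv, hv']
  · refine congrArg card (ext fun v => ?_)
    by_cases hv : v ∈ S <;> by_cases hv' : v ∈ A <;> simp [hv, hv']
  · refine congrArg card (ext fun v => ?_)
    have := hAS' v
    by_cases hv : v ∈ S <;> by_cases hv' : v ∈ A <;> simp_all
  · intro u v
    rw [hadj]
    refine and_congr_right fun _ => ?_
    by_cases hu : u ∈ S <;> by_cases hv : v ∈ S <;> by_cases hu' : u ∈ A <;>
      by_cases hv' : v ∈ A <;> simp [hu, hv, hu', hv']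

lemma nonempty_iso_join_copiesK1_of_adj (hadj : ∀ u v, G.Adj u v ↔ u ≠ v ∧ (u ∉ S ∨ v ∉ S)) :
    Nonempty (G ≃g join (K #Sᶜ) (copiesK1 #S)) := by
  refine nonempty_iso_join_copiesK1 (fun v => if v ∉ S then 0 else 1) ?_ ?_ ?_
  · exact congrArg card (ext fun v => by simp)
  · exact congrArg card (ext fun v => by simp)
  · intro u v
    rw [hadj]
    refine and_congr_right fun _ => ?_
    by_cases hu : u ∈ S <;> by_cases hv : v ∈ S <;> simp [hu, hv]

variable {x y : V}

/-- Losing the edge xy makes x the centre of a star on the rest of S, and y the isolated vertex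
beside it. -/
lemma nonempty_iso_join_Kbip_sum_of_adj (hadj : ∀ u v, G.Adj u v ↔
      u ≠ v ∧ (u ∉ S ∨ v ∉ S) ∧ ¬ (u = x ∧ v = y) ∧ ¬ (u = y ∧ v = x))
    (hx : x ∉ S) (hy : y ∈ S) :
    Nonempty (G ≃g join (K (#Sᶜ - 1)) (SimpleGraph.sum (Kbip 1 (#S - 1)) (K 1))) := by
  have hxy : x ≠ y := fun h => hx (h ▸ hy)
  refine nonempty_iso_join_Kbip_sum
    (fun v => if v = x then 1 else if v = y then 3 else if v ∈ S then 2 else 0) ?_ ?_ ?_ ?_ ?_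
  · rw [← card_erase_of_mem (mem_compl.2 hx)]
    refine congrArg card (ext fun v => ?_)
    by_cases h1 : v = x <;> by_cases h2 : v = y <;> by_cases h3 : v ∈ S <;> simp_all
  · refine Eq.trans (congrArg card (ext fun v => ?_)) (card_singleton x)
    by_cases h1 : v = x <;> by_cases h2 : v = y <;> by_cases h3 : v ∈ S <;> simp_all
  · rw [← card_erase_of_mem hy]
    refine congrArg card (ext fun v => ?_)
    by_cases h1 : v = x <;> by_cases h2 : v = y <;> by_cases h3 : v ∈ S <;> simp_all
  · refine Eq.trans (congrArg card (ext fun v => ?_)) (card_singleton y)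
    by_cases h1 : v = x <;> by_cases h2 : v = y <;> by_cases h3 : v ∈ S <;> simp_all
  · intro u v
    rw [hadj]
    refine and_congr_right fun huv => ?_
    by_cases h1 : v = x <;> by_cases h2 : v = y <;> by_cases h3 : v ∈ S <;>
    by_cases h4 : u = x <;> by_cases h5 : u = y <;> by_cases h6 : u ∈ S <;> simp_all

/-- Here the lost edge lies outside S, so its ends form an independent pair, complete to S. -/
lemma nonempty_iso_join_Kbip_of_adj (hadj : ∀ u v, G.Adj u v ↔
      u ≠ v ∧ (u ∉ S ∨ v ∉ S) ∧ ¬ (u = x ∧ v = y) ∧ ¬ (u = y ∧ v = x))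
    (hx : x ∉ S) (hy : y ∉ S) (hxy : x ≠ y) :
    Nonempty (G ≃g join (K (#Sᶜ - 2)) (Kbip 2 #S)) := by
  refine nonempty_iso_join_Kbip
    (fun v => if v = x ∨ v = y then 1 else if v ∈ S then 2 else 0) ?_ ?_ ?_ ?_
  · rw [show #Sᶜ - 2 = #((Sᶜ.erase x).erase y) by
      rw [card_erase_of_mem (by simp [hy, hxy.symm]), card_erase_of_mem (by simpa)]; omega]
    refine congrArg card (ext fun v => ?_)
    by_cases h1 : v = x <;> by_cases h2 : v = y <;> by_cases h3 : v ∈ S <;> simp_all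
  · refine Eq.trans (congrArg card (ext fun v => ?_)) (card_pair hxy)
    by_cases h1 : v = x <;> by_cases h2 : v = y <;> by_cases h3 : v ∈ S <;> simp_all
  · refine congrArg card (ext fun v => ?_)
    by_cases h1 : v = x <;> by_cases h2 : v = y <;> by_cases h3 : v ∈ S <;> simp_all
  · intro u v
    rw [hadj]
    refine and_congr_right fun huv => ?_
    by_cases h1 : v = x <;> by_cases h2 : v = y <;> by_cases h3 : v ∈ S <;>
    by_cases h4 : u = x <;> by_cases h5 : u = y <;> by_cases h6 : u ∈ S <;> simp_all

end AdjIso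

/-! ### Reading off the graph from its defect. -/

section Defect

variable {G : SimpleGraph V} {A S : Finset V}

variable [DecidableRel G.Adj]

/-- A vertex which misses an edge allowed by the sets `A ⊆ S` has positive defect. -/
lemma degree_lt_degreeBound_of_not_adj {k r : ℕ} (hAS : A ⊆ S)
    (hV : Fintype.card V = 2 * k + 1 + r) (hA : #A = k) (hS : #S = k + 1 + r)
    (hN : ∀ a ∈ A, ∀ w, G.Adj a w → w ∉ S) {x y : V} (hxy : x ≠ y)
    (h : x ∉ S ∨ y ∉ S ∨ (x ∉ A ∧ y ∉ A)) (hadj : ¬ G.Adj x y) :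
    G.degree x < degreeBound A S k (2 * k + 1 + r) x := by
  -- This is the set of permitted neighbours of x; its size is exactly the degree bound at x.
  have hy : y ∈ (if x ∈ A then Sᶜ else if x ∈ S then (insert x A)ᶜ else {x}ᶜ) := by
    have := @hAS x
    have := @hAS y
    split_ifs <;> simp only [mem_compl, mem_insert, mem_singleton, hxy.symm] <;> tauto
  refine (degree_lt_of_not_adj (fun w hw => ?_) hy hadj).trans_le ?_
  · have h1 := not_mem_or_of_adj hN hw
    have h2 := hw.ne.symm
    have h3 := @hAS w
    split_ifs <;> simp only [mem_compl, mem_insert, mem_singleton, h2] <;> tauto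
  · rw [degreeBound]
    split_ifs with h1 h2
    · rw [card_compl, hV, hS]; omega
    · rw [card_compl, card_insert_of_notMem h1, hA, hV]; omega
    · rw [card_compl, card_singleton, hV]

/-- If the total defect is at most two and `S` is independent, then at most one edge between
distinct vertices not both in `S` is missing. -/
lemma adj_of_sum_defect_le_two {d : V → ℕ} (hd : ∑ w, d w ≤ 2)
    (hlt : ∀ x y, x ≠ y → (x ∉ S ∨ y ∉ S) → ¬ G.Adj x y → 1 ≤ d x)
    (hadjS : ∀ x y, G.Adj x y → x ∉ S ∨ y ∉ S) :
    (∀ u v, G.Adj u v ↔ u ≠ v ∧ (u ∉ S ∨ v ∉ S)) ∨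
    ∃ x y, x ∉ S ∧ x ≠ y ∧ ∀ u v, G.Adj u v ↔
      u ≠ v ∧ (u ∉ S ∨ v ∉ S) ∧ ¬ (u = x ∧ v = y) ∧ ¬ (u = y ∧ v = x) := by
  by_cases hall : ∀ x y, x ∉ S → x ≠ y → G.Adj x y
  · refine .inl fun u v => ⟨fun h => ⟨h.ne, hadjS u v h⟩, ?_⟩
    rintro ⟨huv, hu | hv⟩
    · exact hall u v hu huv
    · exact (hall v u hv huv.symm).symm
  push Not at hall
  obtain ⟨x, y, hx, hxy, hnadj⟩ := hall
  have hdx := hlt x y hxy (.inl hx) hnadj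
  have hdy := hlt y x hxy.symm (.inr hx) fun h => hnadj h.symm
  have hother : ∀ z, z ≠ x → z ≠ y → ∀ w, w ≠ z → (w ∉ S ∨ z ∉ S) → G.Adj w z := by
    intro z hzx hzy w hwz h
    by_contra hadj
    have h1 := hlt z w hwz.symm h.symm fun h => hadj h.symm
    have := add_add_le_sum_of_ne d hxy hzx.symm hzy.symm
    omega
  refine .inr ⟨x, y, hx, hxy, fun u v => ⟨fun h => ⟨h.ne, hadjS u v h, ?_, ?_⟩, ?_⟩⟩
  · rintro ⟨rfl, rfl⟩; exact hnadj h
  · rintro ⟨rfl, rfl⟩; exact hnadj h.symm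
  · rintro ⟨huv, h, h1, h2⟩
    by_cases hv : v ≠ x ∧ v ≠ y
    · exact hother v hv.1 hv.2 u huv h
    · refine (hother u ?_ ?_ v huv.symm h.symm).symm
      · rintro rfl
        exact hv ⟨huv.symm, fun h => h1 ⟨rfl, h⟩⟩
      · rintro rfl
        exact hv ⟨fun h => h2 ⟨rfl, h⟩, huv.symm⟩

/-- A graph with many edges all of whose degrees respect the bound `degreeBound A S`, where the
vertices of `A` have neighbours outside `S` only, is exceptional. -/
lemma isExceptional_of_degree_le {k r : ℕ} (hAS : A ⊆ S) (hk : 2 ≤ k)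
    (hV : Fintype.card V = 2 * k + 1 + r) (hA : #A = k) (hS : #S = k + 1 + r)
    (hm : (2 * k + 1 + r - 2).choose 2 + 4 ≤ #G.edgeFinset)
    (hb : ∀ w, G.degree w ≤ degreeBound A S k (2 * k + 1 + r) w)
    (hN : ∀ a ∈ A, ∀ w, G.Adj a w → w ∉ S) : IsExceptional (2 * k + 1 + r) G := by
  have hdef := sum_degree_add_sum_defect G _ hb
  rw [sum_degreeBound hAS hV hA hS] at hdef
  have hcases := defect_cases hk hm hdef
  have hSc : #Sᶜ = k := by rw [card_compl, hV, hS]; omega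
  have hSA : #(S \ A) = r + 1 := by rw [card_sdiff_of_subset hAS, hA, hS]; omega
  set d := fun w => degreeBound A S k (2 * k + 1 + r) w - G.degree w
  have hlt : ∀ x y, x ≠ y → (x ∉ S ∨ y ∉ S ∨ (x ∉ A ∧ y ∉ A)) → ¬ G.Adj x y → 1 ≤ d x :=
    fun x y hxy h hadj =>
      Nat.sub_pos_of_lt (degree_lt_degreeBound_of_not_adj hAS hV hA hS hN hxy h hadj)
  have hfull : ∑ w, d w = 0 →
      Nonempty (G ≃g join (K k) (SimpleGraph.sum (K (r + 1)) (copiesK1 k))) := by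
    intro h0
    have := nonempty_iso_join_sum_of_adj (G := G) hAS fun u v =>
      ⟨fun h => ⟨h.ne, not_mem_or_of_adj hN h⟩, fun h => by_contra fun hadj => by
        have h1 := hlt u v h.1 h.2 hadj
        have h2 := sum_eq_zero_iff.1 h0 u (mem_univ u)
        omega⟩
    rwa [hSc, hSA, hA] at this
  have hadjS : r = 0 → ∀ x y, G.Adj x y → x ∉ S ∨ y ∉ S := by
    intro hr x y hxy
    by_contra! h
    have h1 := not_mem_or_of_adj hN hxy
    -- For r = 0 only one vertex of S lies outside A, so S is independent.
    exact hxy.ne (card_le_one.1 (by omega : #(S \ A) ≤ 1) x (by simp; tauto) y (by simp; tauto))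
  have hlt' : ∀ x y, x ≠ y → (x ∉ S ∨ y ∉ S) → ¬ G.Adj x y → 1 ≤ d x :=
    fun x y hxy h => hlt x y hxy (by tauto)
  have hslack : r = 0 → ∑ w, d w ≤ 2 →
      Nonempty (G ≃g join (K k) (copiesK1 (k + 1))) ∨
      Nonempty (G ≃g join (K (k - 1)) (SimpleGraph.sum (Kbip 1 k) (K 1))) ∨
      Nonempty (G ≃g join (K (k - 2)) (Kbip 2 (k + 1))) := by
    rintro rfl h2
    rcases adj_of_sum_defect_le_two h2 hlt' (hadjS rfl) with hadj | ⟨x, y, hx, hxy, hadj⟩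
    · have := nonempty_iso_join_copiesK1_of_adj hadj
      rw [hSc, hS] at this
      exact .inl this
    · by_cases hy : y ∈ S
      · have := nonempty_iso_join_Kbip_sum_of_adj hadj hx hy
        rw [hSc, hS] at this
        exact .inr (.inl this)
      · have := nonempty_iso_join_Kbip_of_adj hadj hx hy hxy
        rw [hSc, hS] at this
        exact .inr (.inr this)
  rcases hcases with ⟨rfl, h⟩ | ⟨rfl, rfl, h⟩ | ⟨rfl, rfl, h⟩ | ⟨rfl, rfl, h⟩ | ⟨rfl, rfl, h⟩
  · left
    rw [show 2 * 2 + 1 + r - 4 = r + 1 by omega]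
    exact hfull h
  · rcases hslack rfl h with h | h | h
    · exact .inr <| .inl h
    · exact .inr <| .inr <| .inl h
    · exact .inr <| .inr <| .inr <| .inl h
  · exact .inr <| .inr <| .inr <| .inr <| .inl (hfull h)
  · rcases hslack rfl h with h | h | h
    · exact .inr <| .inr <| .inr <| .inr <| .inr <| .inl h
    · exact .inr <| .inr <| .inr <| .inr <| .inr <| .inr <| .inl h
    · exact .inr <| .inr <| .inr <| .inr <| .inr <| .inr <| .inr <| .inl h
  · have hadj : ∀ u v, G.Adj u v ↔ u ≠ v ∧ (u ∉ S ∨ v ∉ S) := fun u v =>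
      ⟨fun h => ⟨h.ne, hadjS rfl u v h⟩, fun h' => by_contra fun hadj => by
        have h1 := hlt' u v h'.1 h'.2 hadj
        have h2 : d u = 0 := sum_eq_zero_iff.1 h u (mem_univ u)
        omega⟩
    have := nonempty_iso_join_copiesK1_of_adj hadj
    rw [hSc, hS] at this
    exact .inr <| .inr <| .inr <| .inr <| .inr <| .inr <| .inr <| .inr this

end Defect

/-! ### Passing to a maximal non-Hamiltonian supergraph. -/

/-- A non-Hamiltonian graph satisfying the hypotheses on order, degrees and size is exceptional. -/
lemma isExceptional_of_not_isHamiltonian (G : SimpleGraph V) [DecidableRel G.Adj] {n : ℕ}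
    (hcard : Fintype.card V = n) (hn : 5 ≤ n) (hδ : 2 ≤ G.minDegree)
    (hm : (n - 2).choose 2 + 4 ≤ #G.edgeFinset) (hG : ¬ G.IsHamiltonian) : IsExceptional n G := by
  classical
  obtain ⟨H, hGH, hH⟩ := Finite.exists_le_maximal (p := fun H : SimpleGraph V => ¬ H.IsHamiltonian) hG
  have hsum : ∀ u v, u ≠ v → ¬ H.Adj u v → H.degree u + H.degree v < n := by
    intro u v huv hadj
    have hlt := H.lt_sup_edge _ _ huv hadj
    have hham : (H ⊔ SimpleGraph.edge u v).IsHamiltonian := by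
      by_contra h
      exact hlt.not_ge (hH.2 h hlt.le)
    obtain ⟨p, hp⟩ := SimpleGraph.exists_isHamiltonian_walk_of_sup_edge (by omega) hH.1 hham
    exact hcard ▸ hp.degree_add_degree_lt (by omega) hH.1
  have htop : H ≠ ⊤ := by
    rintro rfl
    exact hH.1 (SimpleGraph.isHamiltonian_top (by omega))
  obtain ⟨u, A, S, hAS, h2u, hA, hS, hAdeg, hSdeg⟩ := exists_low_degree_sets hcard hsum htop
  have hdeg : ∀ w, G.degree w ≤ H.degree w := fun w => SimpleGraph.degree_le_of_le hGH
  have hk : 2 ≤ H.degree u := (hδ.trans (G.minDegree_le_degree u)).trans (hdeg u)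
  generalize H.degree u = k at *
  obtain ⟨r, rfl⟩ : ∃ r, n = 2 * k + 1 + r := ⟨n - (2 * k + 1), by omega⟩
  have hb : ∀ w, H.degree w ≤ degreeBound A S k (2 * k + 1 + r) w := by
    intro w
    rw [degreeBound]
    split_ifs with h1 h2
    · exact hAdeg w h1
    · have := hSdeg w h2; omega
    · have := H.degree_lt_card_verts w; omega
  have hS' : #S = k + 1 + r := by omega
  have hdef := sum_degree_add_sum_defect H _ hb
  rw [sum_degreeBound hAS hcard hA hS'] at hdef
  have hcases := defect_cases hk
    (hm.trans (card_le_card (SimpleGraph.edgeFinset_subset_edgeFinset.2 hGH))) hdef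
  -- The bounds at c and w add up to at least 2k + r + k, while nonadjacent degrees sum to at most
  -- 2k + r. The defect would be at least k, yet every case has D < k.
  have hC : ∀ c, c ∉ S → ∀ w, c ≠ w → H.Adj c w := by
    intro c hc w hcw
    by_contra hadj
    have h1 := add_le_sum_of_ne
      (fun w => degreeBound A S k (2 * k + 1 + r) w - H.degree w) hcw
    have h2 := hsum c w hcw hadj
    have h3 : degreeBound A S k (2 * k + 1 + r) c = 2 * k + r := by
      rw [degreeBound, if_neg fun h => hc (hAS h), if_neg hc]; omega
    have h4 : k ≤ degreeBound A S k (2 * k + 1 + r) w := by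
      rw [degreeBound]; split_ifs <;> omega
    have h5 := hb w
    have h6 := hb c
    omega
  have hN : ∀ a ∈ A, ∀ w, H.Adj a w → w ∉ S := by
    intro a ha w haw
    have hsub : Sᶜ ⊆ H.neighborFinset a := by
      intro c hc
      rw [mem_compl] at hc
      rw [SimpleGraph.mem_neighborFinset]
      exact (hC c hc a fun h => hc (hAS (h ▸ ha))).symm
    -- The k vertices outside S already exhaust the degree of a, which is at most k.
    have heq := eq_of_subset_of_card_le hsub (by
      rw [H.card_neighborFinset_eq_degree, card_compl, hcard, hS']
      have := hAdeg a ha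
      omega)
    rw [← mem_compl, heq, SimpleGraph.mem_neighborFinset]
    exact haw
  exact isExceptional_of_degree_le hAS hk hcard hA hS' hm (fun w => (hdeg w).trans (hb w))
    fun a ha w haw => hN a ha w (hGH haw)

end HamiltonEdges

theorem lemma2 {V : Type*} [Fintype V] [DecidableEq V] (G : SimpleGraph V) [DecidableRel G.Adj]
    (n : ℕ) (hcard : Fintype.card V = n) (hn : 5 ≤ n) (hδ : 2 ≤ G.minDegree)
    (hm : (n - 2).choose 2 + 4 ≤ G.edgeFinset.card) :
    G.IsHamiltonian ↔ ¬ HamiltonEdges.IsExceptional n G :=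
  ⟨fun h he => he.not_isHamiltonian hn h, fun h => by_contra fun hG =>
    h (HamiltonEdges.isExceptional_of_not_isHamiltonian G hcard hn hδ hm hG)⟩
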